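/- A WMST-instance $I=(G,\hat w,w)$ consists of a finite connected simple graph $G$ with $n$ vertices and two maps $\hat w,w\colon E(G)\to\mathbb R^{+}$, the predicted and the true edge weights. Let $\mathrm{Opt}(I)$ be the minimum of $\sum_{e\in T}w(e)$ over all spanning trees $T$ of $G$. Let $\eta(I)$ be the sum of the $n-1$ largest values among the prediction errors $|w(e)-\hat w(e)|$, $e\in E(G)$ (counted with multiplicity), and let $\varepsilon(I)=\eta(I)/\mathrm{Opt}(I)$ (with $\varepsilon(I)=0$ if $n=1$). The online algorithm Greedy Follow-the-Predictions (GFtP) knows $G$ and $\hat w$ in advance. It starts with a minimum spanning tree $T$ of $G$ with respect to $\hat w$. The edges then arrive one at a time, each with its true weight. When $(e,w(e))$ arrives: if $e\in T$, then $e$ is accepted. If $e\notin T$, let $C'$ be the set of edges that have not yet arrived and that lie on the cycle which $e$ introduces in $T$; if $C'\neq\emptyset$ and $w(e)\le\hat w(e_{\max})$, where $e_{\max}\in C'$ has the largest predicted weight in $C'$, then $e$ is accepted and $T$ is replaced by $(T\setminus\{e_{\max}\})\cup\{e\}$; otherwise $e$ is rejected. The choice of the initial tree (which depends only on $G$ and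 $\hat w$) and the breaking of ties for $e_{\max}$ (which may depend on $G$, $\hat w$ and everything revealed so far) are fixed arbitrarily as part of the algorithm. The cost $\mathrm{GFtP}(I,\sigma)$ is the total true weight of the accepted edges when the edges arrive in the order $\sigma$, and $\mathbb E_\sigma$ denotes the expectation over a uniformly random arrival order $\sigma$ of $E(G)$. For $\varepsilon\ge 0$, the random order ratio is $$\mathrm{ror}_{\mathrm{GFtP}}(\varepsilon)=\inf\{c\in\mathbb R \mid \exists b\in\mathbb R\ \ \forall I \text{ with } \varepsilon(I)=\varepsilon:\ \mathbb E_\sigma[\mathrm{GFtP}(I,\sigma)]\le c\,\mathrm{Opt}(I)-b\}.$$ **Theorem.** For every WMST-instance $I$, $$\mathbb E_\sigma[\mathrm{GFtP}(I,\sigma)]\le\bigl(1+(1+\ln 2)\,\varepsilon(I)\bigr)\,\mathrm{Opt}(I),$$ and, for every $\varepsilon\ge 0$, $$\mathrm{ror}_{\mathrm{GFtP}}(\varepsilon)\le 1+(1+\ln 2)\,\varepsilon .$$ -/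

import Mathlib

open scoped BigOperators

universe u

noncomputable section

namespace WMST

/-- What an online algorithm knows before the weights arrive: a finite connected simple graph and
a positive predicted weight for each of its edges. -/
structure PredictedGraph where
  V : Type u
  [fintypeV : Fintype V]
  G : SimpleGraph V
  connected : G.Connected
  pred : G.edgeSet → ℝ
  pred_pos : ∀ e, 0 < pred e

attribute [instance] PredictedGraph.fintypeV

/-- The edges of the graph, as a type. -/
abbrev PredictedGraph.Edge (P : PredictedGraph.{u}) : Type u := P.G.edgeSet

instance PredictedGraph.decidableEqEdge (P : PredictedGraph.{u}) : DecidableEq P.Edge :=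
  Classical.decEq _

instance PredictedGraph.fintypeEdge (P : PredictedGraph.{u}) : Fintype P.Edge :=
  Fintype.ofFinite _

/-- A WMST-instance: a finite connected graph with predicted and true edge weights, all positive. -/
structure Instance extends PredictedGraph.{u} where
  weight : toPredictedGraph.Edge → ℝ
  weight_pos : ∀ e, 0 < weight e

section Trees

/-- The subgraph (on all vertices) formed by a set of edges of the graph. -/
def PredictedGraph.subgraphOf (P : PredictedGraph.{u}) (T : Finset P.Edge) : SimpleGraph P.V :=
  SimpleGraph.fromEdgeSet {x | ∃ e ∈ T, (e : Sym2 P.V) = x}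

/-- `T` is (the edge set of) a spanning tree. -/
def PredictedGraph.IsSpanningTree (P : PredictedGraph.{u}) (T : Finset P.Edge) : Prop :=
  (P.subgraphOf T).IsTree

/-- The cost of a set of edges with respect to the weights `w`. -/
def PredictedGraph.cost (P : PredictedGraph.{u}) (w : P.Edge → ℝ) (T : Finset P.Edge) : ℝ :=
  ∑ e ∈ T, w e

/-- `T` is a minimum spanning tree with respect to the weights `w`. -/
def PredictedGraph.IsMST (P : PredictedGraph.{u}) (w : P.Edge → ℝ) (T : Finset P.Edge) : Prop :=
  P.IsSpanningTree T ∧ ∀ T' : Finset P.Edge, P.IsSpanningTree T' → P.cost w T ≤ P.cost w T'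

/-- `P.OnCycle T e f`: the edge `f` lies on a cycle of `T ∪ {e}`. If `T` is a spanning tree and
`e ∉ T`, these `f` are exactly the edges of the unique cycle that `e` introduces in `T`. -/
def PredictedGraph.OnCycle (P : PredictedGraph.{u}) (T : Finset P.Edge) (e f : P.Edge) : Prop :=
  ∃ (v : P.V) (p : (P.subgraphOf (insert e T)).Walk v v), p.IsCycle ∧ (f : Sym2 P.V) ∈ p.edges

end Trees

/-- `Opt(w)`: the least cost of a spanning tree with respect to the true weights. -/
def Instance.opt (I : Instance.{u}) : ℝ :=
  sInf {c | ∃ T : Finset I.Edge, I.IsSpanningTree T ∧ I.cost I.weight T = c}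

/-- The prediction errors `|w(e) - ŵ(e)|` of all edges, sorted in non-increasing order. -/
def Instance.sortedErrors (I : Instance.{u}) : List ℝ :=
  ((Finset.univ : Finset I.Edge).val.map fun e => |I.weight e - I.pred e|).sort (· ≥ ·)

/-- The error `η`: the sum of the `n - 1` largest prediction errors, `n` the number of vertices. -/
def Instance.error (I : Instance.{u}) : ℝ :=
  (I.sortedErrors.take (Fintype.card I.V - 1)).sum

/-- The normalized error `ε = η / Opt`. (On the one-vertex graph `η = Opt = 0`, and `ε` is `0`.) -/
def Instance.normalizedError (I : Instance.{u}) : ℝ :=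
  I.error / I.opt

/-- The two choices that Greedy Follow-the-Predictions leaves open: which minimum spanning tree
for the predictions it starts from, and how it breaks ties when it picks an edge of largest
predicted weight. The latter choice may depend on everything revealed so far (edges with their true
weights, in order of arrival), but not on the future. -/
structure TieBreaking (P : PredictedGraph.{u}) where
  init : Finset P.Edge
  init_isMST : P.IsMST P.pred init
  argmax : List (P.Edge × ℝ) → (C : Finset P.Edge) → C.Nonempty → P.Edge
  argmax_mem : ∀ h C hC, argmax h C hC ∈ C
  le_argmax : ∀ h C hC, ∀ f ∈ C, P.pred f ≤ P.pred (argmax h C hC)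

/-- The state of Greedy Follow-the-Predictions: its current tree, the unseen edges, the edges
accepted so far, and the requests seen so far. -/
structure State (P : PredictedGraph.{u}) where
  tree : Finset P.Edge
  unseen : Finset P.Edge
  accepted : Finset P.Edge
  history : List (P.Edge × ℝ)

namespace TieBreaking

variable {P : PredictedGraph.{u}}

/-- The state before the first request. -/
def initialState (R : TieBreaking P) : State P where
  tree := R.init
  unseen := Finset.univ
  accepted := ∅
  history := []

open scoped Classical in
/-- How Greedy Follow-the-Predictions processes the request `r = (e, w(e))`. -/
def step (R : TieBreaking P) (s : State P) (r : P.Edge × ℝ) : State P :=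
  let U := s.unseen.erase r.1
  let h := s.history ++ [r]
  let C := U.filter fun f => P.OnCycle s.tree r.1 f
  if r.1 ∈ s.tree then
    { tree := s.tree, unseen := U, accepted := insert r.1 s.accepted, history := h }
  else if hC : C.Nonempty then
    if r.2 ≤ P.pred (R.argmax h C hC) then
      { tree := insert r.1 (s.tree.erase (R.argmax h C hC)), unseen := U,
        accepted := insert r.1 s.accepted, history := h }
    else
      { tree := s.tree, unseen := U, accepted := s.accepted, history := h }
  else
    { tree := s.tree, unseen := U, accepted := s.accepted, history := h }

/-- The set of edges accepted by Greedy Follow-the-Predictions on a sequence of requests. -/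
def output (R : TieBreaking P) (requests : List (P.Edge × ℝ)) : Finset P.Edge :=
  (requests.foldl R.step R.initialState).accepted

end TieBreaking

/-- The arrival orders of the edges. -/
abbrev PredictedGraph.Order (P : PredictedGraph.{u}) : Type u :=
  Fin (Fintype.card P.Edge) ≃ P.Edge

/-- The request sequence of an instance under the arrival order `σ`. -/
def Instance.requests (I : Instance.{u}) (σ : I.Order) : List (I.Edge × ℝ) :=
  List.ofFn fun i => (σ i, I.weight (σ i))

/-- A version of Greedy Follow-the-Predictions: all open choices are fixed, for every graph with
predictions and without knowledge of the true weights. -/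
abbrev GFtP : Type (u + 1) := (P : PredictedGraph.{u}) → TieBreaking P

/-- The cost of Greedy Follow-the-Predictions on the instance `I` with arrival order `σ`. -/
def GFtP.algCost (A : GFtP.{u}) (I : Instance.{u}) (σ : I.Order) : ℝ :=
  I.cost I.weight ((A I.toPredictedGraph).output (I.requests σ))

/-- The expected cost of Greedy Follow-the-Predictions when the arrival order is chosen uniformly
at random. -/
def GFtP.expectedCost (A : GFtP.{u}) (I : Instance.{u}) : ℝ :=
  (∑ σ : I.Order, A.algCost I σ) / (Fintype.card I.Order : ℝ)

/-- The random order ratio as a function of the normalized error `ε`: the infimum (in the extended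
reals) of all real `c` for which there is a constant `b` with `𝔼[Alg(σ(I))] ≤ c Opt(I) - b` for all
instances `I` of normalized error `ε`. -/
def GFtP.randomOrderRatio (A : GFtP.{u}) (ε : ℝ) : EReal :=
  sInf {x : EReal | ∃ c : ℝ, (c : EReal) = x ∧
    ∃ b : ℝ, ∀ I : Instance.{u}, I.normalizedError = ε → A.expectedCost I ≤ c * I.opt - b}

end WMST

end

/-! The argument gives the stronger bound `opt + 5/3 * error`, and 5/3 < 1 + ln 2. Next to the
current tree T of the algorithm, a reference tree B is carried along each run. It starts as an
optimal tree, always contains the accepted edges and otherwise uses only unseen ones, so at the end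
B and T both equal the output. Each request changes B by at most one exchange, chosen so that B
becomes dearer only by prediction errors of edges not charged before (`Ledger.Valid.exists_step`).
These comparisons work because T stays cheapest, for the predictions, among the spanning trees that
can still be completed (`State.Valid.step`).

Every accepted edge causes at most one charge, and one more if it was requested while in T \ B. With
k = n - 1 and p hits of T \ B, at most k + p distinct errors are charged. For a threshold θ with kθ
≤ η, they sum to at most η + pθ (`exists_threshold_error`).

It remains to bound p. The potential |accepted| + |B ∩ T| ends at 2k and never falls; a hit of T \ B
raises it by at least 2, a hit of B \ T by at least 1. So 2p + q ≤ 2k, where q counts the hits of B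
\ T. Both differences consist of unseen edges and have equal size, so in random order the next
request hits either with the same probability (`sum_ofFn_eq_of_sum_append_eq`). Thus E p = E q,
whence E p ≤ 2k/3 and the expected extra cost is at most η + (2/3)kθ ≤ (5/3)η. -/

namespace WMST

/-! ### Spanning trees and edge exchanges. -/

namespace PredictedGraph

variable {P : PredictedGraph.{u}}

theorem edgeSet_subgraphOf (T : Finset P.Edge) :
    (P.subgraphOf T).edgeSet = (fun e : P.Edge => (e : Sym2 P.V)) '' (T : Set P.Edge) := by
  ext x
  simp only [subgraphOf, SimpleGraph.edgeSet_fromEdgeSet, Set.mem_sdiff, Set.mem_ofPred_eq,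
    Set.mem_image, Finset.mem_coe, and_iff_left_iff_imp]
  rintro ⟨e, -, rfl⟩
  exact P.G.not_isDiag_of_mem_edgeSet e.2

theorem mem_edgeSet_subgraphOf {T : Finset P.Edge} {e : P.Edge} :
    (e : Sym2 P.V) ∈ (P.subgraphOf T).edgeSet ↔ e ∈ T := by
  rw [edgeSet_subgraphOf]
  simp

theorem subgraphOf_erase (T : Finset P.Edge) (e : P.Edge) :
    P.subgraphOf (T.erase e) = (P.subgraphOf T).deleteEdges {(e : Sym2 P.V)} := by
  rw [← SimpleGraph.edgeSet_inj, SimpleGraph.edgeSet_deleteEdges, edgeSet_subgraphOf,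
    edgeSet_subgraphOf, Finset.coe_erase, Set.image_sdiff Subtype.val_injective, Set.image_singleton]

theorem subgraphOf_mono {S T : Finset P.Edge} (h : S ⊆ T) : P.subgraphOf S ≤ P.subgraphOf T := by
  rw [← SimpleGraph.edgeSet_subset_edgeSet, edgeSet_subgraphOf, edgeSet_subgraphOf]
  exact Set.image_mono (Finset.coe_subset.2 h)

theorem isSpanningTree_iff {T : Finset P.Edge} :
    P.IsSpanningTree T ↔ (P.subgraphOf T).Connected ∧ T.card + 1 = Fintype.card P.V := by
  rw [IsSpanningTree, SimpleGraph.isTree_iff_connected_and_card, edgeSet_subgraphOf,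
    Nat.card_image_of_injective Subtype.val_injective, Nat.card_eq_fintype_card (α := P.V)]
  simp

theorem IsSpanningTree.card {T : Finset P.Edge} (hT : P.IsSpanningTree T) :
    T.card + 1 = Fintype.card P.V := (isSpanningTree_iff.1 hT).2

/-- The exchanged set has the right number of edges, so only connectedness is at stake, and deleting
f preserves it exactly if f is not a bridge. -/
theorem IsSpanningTree.isSpanningTree_exchange_iff {T : Finset P.Edge} (hT : P.IsSpanningTree T)
    {e f : P.Edge} (he : e ∉ T) (hf : f ∈ T) :
    P.IsSpanningTree (insert e (T.erase f)) ↔ ¬ (P.subgraphOf (insert e T)).IsBridge (f : Sym2 P.V) := by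
  have hef : f ≠ e := fun h => he (h ▸ hf)
  have hconn : (P.subgraphOf (insert e T)).Connected :=
    (isSpanningTree_iff.1 hT).1.mono (subgraphOf_mono (Finset.subset_insert _ _))
  have hcard : (insert e (T.erase f)).card = T.card := by
    rw [Finset.card_insert_of_notMem (fun h => he (Finset.mem_of_mem_erase h)),
      Finset.card_erase_add_one hf]
  rw [isSpanningTree_iff, hcard, and_iff_left hT.card, ← Finset.erase_insert_of_ne hef.symm,
    subgraphOf_erase]
  generalize (f : Sym2 P.V) = x
  induction x with | h a b =>
  refine ⟨fun h => ?_, fun h => hconn.connected_delete_edge_of_not_isBridge h⟩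
  rw [SimpleGraph.isBridge_iff, not_not]
  exact h.preconnected a b

/-- Non-bridges are the edges on cycles. This turns the cycle test of the algorithm into exchanges
of tree edges; f ≠ e is needed because e lies on its own cycle. -/
theorem IsSpanningTree.onCycle_iff {T : Finset P.Edge} (hT : P.IsSpanningTree T)
    {e f : P.Edge} (he : e ∉ T) (hef : f ≠ e) :
    P.OnCycle T e f ↔ f ∈ T ∧ P.IsSpanningTree (insert e (T.erase f)) := by
  by_cases hf : f ∈ T
  · rw [hT.isSpanningTree_exchange_iff he hf, SimpleGraph.isBridge_iff_forall_cycle_notMem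
      (mem_edgeSet_subgraphOf.2 (Finset.mem_insert_of_mem hf))]
    simp [OnCycle, hf]
  · simp only [hf, false_and, iff_false]
    rintro ⟨v, p, -, hp⟩
    have := mem_edgeSet_subgraphOf.1 (p.edges_subset_edgeSet hp)
    simp [hef, hf] at this

theorem IsSpanningTree.isSpanningTree_of_mem_edges {T : Finset P.Edge} (hT : P.IsSpanningTree T)
    {e f : P.Edge} (he : e ∉ T) {a b : P.V} (hab : (e : Sym2 P.V) = s(a, b))
    (p : (P.subgraphOf T).Walk b a) (hp : p.IsPath) (hf : (f : Sym2 P.V) ∈ p.edges) :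
    f ∈ T ∧ P.IsSpanningTree (insert e (T.erase f)) := by
  have hfT : f ∈ T := mem_edgeSet_subgraphOf.1 (p.edges_subset_edgeSet hf)
  refine (hT.onCycle_iff he (fun h => he (h ▸ hfT))).1 ?_
  have hle := subgraphOf_mono (P := P) (Finset.subset_insert e T)
  have hadj : (P.subgraphOf (insert e T)).Adj a b := by
    rw [← SimpleGraph.mem_edgeSet, ← hab, mem_edgeSet_subgraphOf]
    exact Finset.mem_insert_self _ _
  refine ⟨a, .cons hadj (p.mapLe hle),
    SimpleGraph.Path.cons_isCycle ⟨p.mapLe hle, hp.mapLe hle⟩ hadj ?_, ?_⟩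
  · rw [← hab]
    simp only [SimpleGraph.Walk.edges_mapLe_eq_edges]
    exact fun h => he (mem_edgeSet_subgraphOf.1 (p.edges_subset_edgeSet h))
  · simp [hf]

/-- The strong exchange property of spanning trees. -/
theorem IsSpanningTree.exists_exchange {S T : Finset P.Edge} (hS : P.IsSpanningTree S)
    (hT : P.IsSpanningTree T) {e : P.Edge} (heS : e ∈ S) (heT : e ∉ T) :
    ∃ f ∈ T, f ∉ S ∧ P.IsSpanningTree (insert e (T.erase f)) ∧
      P.IsSpanningTree (insert f (S.erase e)) := by
  classical
  obtain ⟨a, b, hab⟩ : ∃ a b, (e : Sym2 P.V) = s(a, b) := by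
    induction (e : Sym2 P.V) with | h a b => exact ⟨a, b, rfl⟩
  -- Removing e = ab cuts S into two sides; the path from b to a in T has to cross this cut, and a
  -- crossing edge is the desired f.
  have hbr : ¬ ((P.subgraphOf S).deleteEdges {s(a, b)}).Reachable b a := by
    have := SimpleGraph.isAcyclic_iff_forall_isBridge.1 hS.isAcyclic
      (mem_edgeSet_subgraphOf.2 heS)
    rwa [hab, SimpleGraph.isBridge_iff, SimpleGraph.reachable_comm] at this
  obtain ⟨p, hp⟩ := hT.connected.exists_isPath b a
  obtain ⟨d, hd, hd1, hd2⟩ := p.exists_boundary_dart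
    {x | ((P.subgraphOf S).deleteEdges {s(a, b)}).Reachable b x} (by simp) hbr
  simp only [Set.mem_ofPred_eq] at hd1 hd2
  have hdp : d.edge ∈ p.edges := List.mem_map_of_mem hd
  have hdT := p.edges_subset_edgeSet hdp
  rw [edgeSet_subgraphOf] at hdT
  obtain ⟨f, hfT, hf⟩ := hdT
  have hf' : (f : Sym2 P.V) = s(d.fst, d.snd) := hf
  have hfS : f ∉ S := by
    intro h
    refine hd2 (hd1.trans (SimpleGraph.Adj.reachable ?_))
    rw [SimpleGraph.deleteEdges_adj, ← SimpleGraph.mem_edgeSet, ← hf', mem_edgeSet_subgraphOf]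
    refine ⟨h, fun h' => heT ?_⟩
    rw [Set.mem_singleton_iff, ← hab, Subtype.coe_inj] at h'
    exact h' ▸ hfT
  refine ⟨f, hfT, hfS, (hT.isSpanningTree_of_mem_edges heT hab p hp (hf' ▸ hdp)).2, ?_⟩
  -- The path in S between the ends of f must use e, since without e these ends lie on different
  -- sides of the cut.
  obtain ⟨r, hr⟩ := hS.connected.exists_isPath d.snd d.fst
  refine (hS.isSpanningTree_of_mem_edges (f := e) hfS hf' r hr ?_).2
  by_contra hcon
  rw [hab] at hcon
  exact hd2 (hd1.trans (SimpleGraph.reachable_deleteEdges_iff_exists_walk.2 ⟨r, hcon⟩).symm)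

end PredictedGraph

/-! ### One step of the algorithm and its invariants. -/

variable {P : PredictedGraph.{u}}

namespace TieBreaking

/-- The three ways in which a request can be processed. -/
theorem step_cases (R : TieBreaking P) (s : State P) (e : P.Edge) (r : ℝ) :
    (R.step s (e, r)).unseen = s.unseen.erase e ∧
    ((e ∈ s.tree ∧ (R.step s (e, r)).tree = s.tree ∧
        (R.step s (e, r)).accepted = insert e s.accepted) ∨
      (e ∉ s.tree ∧ ∃ g ∈ s.unseen.erase e, P.OnCycle s.tree e g ∧
        (∀ f ∈ s.unseen.erase e, P.OnCycle s.tree e f → P.pred f ≤ P.pred g) ∧ r ≤ P.pred g ∧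
        (R.step s (e, r)).tree = insert e (s.tree.erase g) ∧
        (R.step s (e, r)).accepted = insert e s.accepted) ∨
      (e ∉ s.tree ∧ (R.step s (e, r)).tree = s.tree ∧ (R.step s (e, r)).accepted = s.accepted ∧
        ∀ f ∈ s.unseen.erase e, P.OnCycle s.tree e f → P.pred f < r)) := by
  classical
  by_cases he : e ∈ s.tree
  · simp [step, he]
  by_cases hC : ((s.unseen.erase e).filter fun f => P.OnCycle s.tree e f).Nonempty
  · have hmem := R.argmax_mem (s.history ++ [(e, r)]) _ hC
    have hle := R.le_argmax (s.history ++ [(e, r)]) _ hC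
    by_cases hr : r ≤ P.pred (R.argmax (s.history ++ [(e, r)]) _ hC)
    · refine ⟨by simp only [step, he, hC, hr, if_true, if_false, dite_true], .inr (.inl ⟨he,
        R.argmax (s.history ++ [(e, r)]) _ hC, (Finset.mem_filter.1 hmem).1,
        (Finset.mem_filter.1 hmem).2, fun f hf hc => hle f (Finset.mem_filter.2 ⟨hf, hc⟩), hr, ?_, ?_⟩)⟩
      · simp only [step, he, hC, hr, if_true, if_false, dite_true]
      · simp only [step, he, hC, hr, if_true, if_false, dite_true]
    · refine ⟨by simp only [step, he, hC, hr, if_false, dite_true], .inr (.inr ⟨he, ?_, ?_,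
        fun f hf hc => (hle f (Finset.mem_filter.2 ⟨hf, hc⟩)).trans_lt (not_le.1 hr)⟩)⟩
      · simp only [step, he, hC, hr, if_false, dite_true]
      · simp only [step, he, hC, hr, if_false, dite_true]
  · refine ⟨by simp only [step, he, hC, if_false, dite_false], .inr (.inr ⟨he, ?_, ?_,
      fun f hf hc => (hC ⟨f, Finset.mem_filter.2 ⟨hf, hc⟩⟩).elim⟩)⟩
    · simp only [step, he, hC, if_false, dite_false]
    · simp only [step, he, hC, if_false, dite_false]

end TieBreaking

/-- The invariants of Greedy Follow-the-Predictions. In particular, the current tree is cheapest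
for the predictions among the trees that the accepted edges and unseen edges can still form. -/
structure State.Valid (s : State P) : Prop where
  tree : P.IsSpanningTree s.tree
  accepted_subset : s.accepted ⊆ s.tree
  tree_subset : s.tree ⊆ s.accepted ∪ s.unseen
  disjoint : Disjoint s.accepted s.unseen
  cost_le : ∀ S, P.IsSpanningTree S → s.accepted ⊆ S → S ⊆ s.accepted ∪ s.unseen →
    P.cost P.pred s.tree ≤ P.cost P.pred S

namespace PredictedGraph

theorem cost_insert_erase (w : P.Edge → ℝ) {T : Finset P.Edge} {e f : P.Edge} (he : e ∉ T)
    (hf : f ∈ T) : P.cost w (insert e (T.erase f)) = P.cost w T + w e - w f := by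
  rw [cost, cost, Finset.sum_insert (fun h => he (Finset.mem_of_mem_erase h)),
    Finset.sum_erase_eq_sub hf]
  ring

end PredictedGraph

namespace State.Valid

variable {s : State P}

/-- Both edges are unseen, so the exchanged tree is still a possible completion and cannot be
cheaper for the predictions than the current one. -/
theorem pred_le (hs : s.Valid) {e f : P.Edge} (he : e ∈ s.tree) (heu : e ∈ s.unseen)
    (hf : f ∉ s.tree) (hfu : f ∈ s.unseen) (h : P.IsSpanningTree (insert f (s.tree.erase e))) :
    P.pred e ≤ P.pred f := by
  have hea : e ∉ s.accepted := fun h => Finset.disjoint_left.1 hs.disjoint h heu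
  have h1 := hs.accepted_subset
  have h2 := hs.tree_subset
  have := hs.cost_le _ h (by grind) (by grind)
  rw [PredictedGraph.cost_insert_erase _ hf he] at this
  linarith

theorem initial (R : TieBreaking P) : R.initialState.Valid where
  tree := R.init_isMST.1
  accepted_subset := by simp [TieBreaking.initialState]
  tree_subset := by simp [TieBreaking.initialState]
  disjoint := by simp [TieBreaking.initialState]
  cost_le := fun S hS _ _ => R.init_isMST.2 S hS

/-- Optimality needs an argument only after a swap; in the other cases the tree stays and the set of
competing completions does not grow. -/
theorem step (hs : s.Valid) (R : TieBreaking P) {e : P.Edge} (he : e ∈ s.unseen) (r : ℝ) :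
    (R.step s (e, r)).Valid := by
  obtain ⟨hu, ⟨heT, hT, hA⟩ | ⟨heT, g, hg, hcyc, hmax, -, hT, hA⟩ | ⟨heT, hT, hA, -⟩⟩ :=
    R.step_cases s e r
  all_goals
    have h1 := hs.accepted_subset
    have h2 := hs.tree_subset
    have h3 := Finset.disjoint_left.1 hs.disjoint
  · constructor
    · exact hT ▸ hs.tree
    · grind
    · grind
    · rw [Finset.disjoint_left]; grind
    · rw [hT, hA, hu]
      exact fun S hS hS1 hS2 => hs.cost_le S hS (by grind) (by grind)
  · rw [Finset.mem_erase] at hg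
    obtain ⟨hgT, hspan⟩ := (hs.tree.onCycle_iff heT hg.1).1 hcyc
    constructor
    · exact hT ▸ hspan
    · grind
    · grind
    · rw [Finset.disjoint_left]; grind
    · rw [hT, hA, hu]
      intro S hS hS1 hS2
      have heS : e ∈ S := hS1 (Finset.mem_insert_self _ _)
      -- S - e + f competes with the old tree T, so T costs at most S - e + f. As f lies on the
      -- cycle of e, it is predicted no dearer than g, and T - g + e costs at most S.
      obtain ⟨f, hfT, hfS, hf1, hf2⟩ := hS.exists_exchange hs.tree heS heT
      have hfe : f ≠ e := fun h => hfS (h ▸ heS)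
      have hfu : f ∈ s.unseen := by grind
      have hle := hmax f (Finset.mem_erase.2 ⟨hfe, hfu⟩)
        ((hs.tree.onCycle_iff heT hfe).2 ⟨hfT, hf1⟩)
      have := hs.cost_le _ hf2 (by grind) (by grind)
      rw [PredictedGraph.cost_insert_erase _ hfS heS] at this
      rw [PredictedGraph.cost_insert_erase _ heT hgT]
      linarith
  · constructor
    · exact hT ▸ hs.tree
    · grind
    · grind
    · rw [Finset.disjoint_left]; grind
    · rw [hT, hA, hu]
      exact fun S hS hS1 hS2 => hs.cost_le S hS (by grind) (by grind)

end State.Valid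

/-! ### The reference tree and the charging of errors. -/

/-- The bookkeeping of the analysis along a run of the algorithm: its state, a reference tree that
starts as an optimal tree and ends as the output, the edges of the reference tree that count with
their predicted weight, the edges whose prediction error has been charged, and the numbers of
requests that hit the tree but not the reference tree, and vice versa. -/
structure Ledger (P : PredictedGraph.{u}) where
  state : State P
  ref : Finset P.Edge
  flagged : Finset P.Edge
  charged : Finset P.Edge
  treeHits : ℕ
  refHits : ℕ

/-- The weight of an edge that counts with its predicted weight if it is flagged. -/
noncomputable def Instance.mixedWeight (I : Instance.{u}) (F : Finset I.Edge) (e : I.Edge) : ℝ :=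
  if e ∈ F then I.pred e else I.weight e

/-- The prediction error of an edge. -/
noncomputable def Instance.edgeError (I : Instance.{u}) (e : I.Edge) : ℝ := |I.weight e - I.pred e|

/-- The invariants of the bookkeeping. -/
structure Ledger.Valid (I : Instance.{u}) (l : Ledger I.toPredictedGraph) : Prop where
  state : l.state.Valid
  ref : I.IsSpanningTree l.ref
  accepted_subset : l.state.accepted ⊆ l.ref
  ref_subset : l.ref ⊆ l.state.accepted ∪ l.state.unseen
  flagged_subset_ref : l.flagged ⊆ l.ref
  flagged_subset_unseen : l.flagged ⊆ l.state.unseen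
  notMem_of_charged : ∀ z ∈ l.charged, z ∈ l.state.unseen → z ∉ l.state.tree ∧ z ∉ l.ref
  cost_le : I.cost (I.mixedWeight l.flagged) l.ref ≤ I.opt + ∑ z ∈ l.charged, I.edgeError z
  card_charged_le : l.charged.card ≤ l.treeHits + l.state.accepted.card
  hits_le : 2 * l.treeHits + l.refHits ≤ l.state.accepted.card + (l.ref ∩ l.state.tree).card

namespace Ledger.Valid

variable {I : Instance.{u}} {l : Ledger I.toPredictedGraph}

theorem notMem_accepted (hl : l.Valid I) {e : I.Edge} (he : e ∈ l.state.unseen) :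
    e ∉ l.state.accepted := fun h => Finset.disjoint_left.1 hl.state.disjoint h he

/-- A request for an edge of the reference tree is accepted. -/
theorem accept_ref (hl : l.Valid I) {e : I.Edge} (he : e ∈ l.state.unseen) (heB : e ∈ l.ref)
    {s : State I.toPredictedGraph} (hs : s.Valid) (hu : s.unseen = l.state.unseen.erase e)
    (hA : s.accepted = insert e l.state.accepted) (hT : s.tree ⊆ insert e l.state.tree) {q : ℕ}
    (hq : q + (l.ref ∩ l.state.tree).card ≤ l.refHits + 1 + (l.ref ∩ s.tree).card) :
    (Ledger.mk s l.ref (l.flagged.erase e) (if e ∈ l.flagged then insert e l.charged else l.charged)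
      l.treeHits q).Valid I := by
  have h0 := hl.notMem_accepted he
  have h1 := hl.accepted_subset
  have h2 := hl.ref_subset
  have h3 := hl.flagged_subset_ref
  have h4 := hl.flagged_subset_unseen
  have h5 := hl.notMem_of_charged
  have hcard : s.accepted.card = l.state.accepted.card + 1 := by
    rw [hA, Finset.card_insert_of_notMem h0]
  have h6 := hl.cost_le
  have h7 := hl.card_charged_le
  have h8 := hl.hits_le
  -- No error is charged twice: an edge that is charged while unseen has left both trees for good.
  have heZ : e ∉ l.charged := fun h => (h5 e h he).2 heB
  refine ⟨hs, hl.ref, by grind, by grind, by grind, by grind, ?_, ?_, ?_, by dsimp only; omega⟩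
  · dsimp only
    intro z hz hz'
    have : z ≠ e := by grind
    have : z ∈ l.charged := by grind
    grind
  · dsimp only
    -- A flagged edge now has to count with its true weight, which costs at most its own error.
    split_ifs with hF
    · have key : I.cost (I.mixedWeight (l.flagged.erase e)) l.ref
          = I.cost (I.mixedWeight l.flagged) l.ref + (I.weight e - I.pred e) := by
        simp only [PredictedGraph.cost]
        rw [← Finset.add_sum_erase _ _ heB, ← Finset.add_sum_erase _ _ heB]
        have : ∑ x ∈ l.ref.erase e, I.mixedWeight (l.flagged.erase e) x
            = ∑ x ∈ l.ref.erase e, I.mixedWeight l.flagged x :=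
          Finset.sum_congr rfl fun x hx => by
            simp [Instance.mixedWeight, Finset.ne_of_mem_erase hx]
        rw [this]
        simp only [Instance.mixedWeight, Finset.mem_erase, hF]
        simp
        ring
      rw [Finset.sum_insert heZ, key]
      have : I.weight e - I.pred e ≤ I.edgeError e := le_abs_self _
      linarith
    · rwa [Finset.erase_eq_of_notMem hF]
  · dsimp only
    split_ifs
    · rw [Finset.card_insert_of_notMem heZ]; omega
    · omega

/-- A request for an edge of the reference tree is rejected. -/
theorem reject_ref (hl : l.Valid I) {e : I.Edge} (he : e ∈ l.state.unseen) (heB : e ∈ l.ref)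
    (heT : e ∉ l.state.tree)
    {s : State I.toPredictedGraph} (hs : s.Valid) (hu : s.unseen = l.state.unseen.erase e)
    (hA : s.accepted = l.state.accepted) (hT : s.tree = l.state.tree)
    (hlt : ∀ f ∈ l.state.unseen.erase e, I.OnCycle l.state.tree e f → I.pred f < I.weight e) :
    ∃ B F, (Ledger.mk s B F l.charged l.treeHits (l.refHits + 1)).Valid I := by
  have h0 := hl.notMem_accepted he
  have h1 := hl.accepted_subset
  have h2 := hl.ref_subset
  have h3 := hl.flagged_subset_ref
  have h4 := hl.flagged_subset_unseen
  have h5 := hl.notMem_of_charged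
  have h6 := hl.cost_le
  have h7 := hl.card_charged_le
  have h8 := hl.hits_le
  -- The replacement f in T is flagged. Its prediction is below the true weight of e by the
  -- rejection and at most the prediction of e by optimality of T, so nothing is charged whether or
  -- not e was flagged.
  obtain ⟨f, hfT, hfB, hf1, hf2⟩ := hl.ref.exists_exchange hl.state.tree heB heT
  have hfe : f ≠ e := fun h => hfB (h ▸ heB)
  have hfu : f ∈ l.state.unseen := by
    have := hl.state.tree_subset
    grind
  have hw := hlt f (Finset.mem_erase.2 ⟨hfe, hfu⟩)
    ((hl.state.tree.onCycle_iff heT hfe).2 ⟨hfT, hf1⟩)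
  have hp := hl.state.pred_le hfT hfu heT he hf1
  refine ⟨insert f (l.ref.erase e), insert f (l.flagged.erase e), hs, hf2, by grind, by grind,
    by grind, by grind, by grind, ?_, by grind, ?_⟩
  · refine le_trans ?_ h6
    dsimp only
    have : ∑ x ∈ l.ref.erase e, I.mixedWeight (insert f (l.flagged.erase e)) x
        = ∑ x ∈ l.ref.erase e, I.mixedWeight l.flagged x :=
      Finset.sum_congr rfl fun x hx => by
        have : x ≠ f := by grind
        simp [Instance.mixedWeight, Finset.ne_of_mem_erase hx, this]
    simp only [PredictedGraph.cost]
    rw [Finset.sum_insert (by grind), this, ← Finset.add_sum_erase _ _ heB]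
    refine add_le_add_left ?_ _
    simp only [Instance.mixedWeight, Finset.mem_insert_self, if_true]
    split_ifs
    · exact hp
    · exact hw.le
  · dsimp only
    -- The new common edge f pays for the hit of B \ T.
    have : insert f (l.ref ∩ l.state.tree) ⊆ insert f (l.ref.erase e) ∩ s.tree := by grind
    have := Finset.card_le_card this
    rw [Finset.card_insert_of_notMem (by grind)] at this
    rw [hA]
    omega

/-- A request for an edge outside of the reference tree is accepted. -/
theorem accept_of_notMem_ref (hl : l.Valid I) {e x : I.Edge} (he : e ∈ l.state.unseen)
    (heB : e ∉ l.ref)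
    {s : State I.toPredictedGraph} (hs : s.Valid) (hu : s.unseen = l.state.unseen.erase e)
    (hA : s.accepted = insert e l.state.accepted) (hT : s.tree ⊆ insert e l.state.tree)
    (hxB : x ∈ l.ref) (hxT : x ∉ s.tree)
    (hx : I.IsSpanningTree (insert e (l.ref.erase x)))
    (hwe : I.weight e - I.pred x ≤ if e ∈ l.state.tree then I.edgeError e else 0) {p : ℕ}
    (hp : l.treeHits + (if e ∈ l.state.tree then 1 else 0) ≤ p)
    (hq : 2 * p + (l.ref ∩ l.state.tree).card ≤
      2 * l.treeHits + 1 + (insert e (l.ref.erase x) ∩ s.tree).card) :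
    (Ledger.mk s (insert e (l.ref.erase x)) (l.flagged.erase x)
      ((if x ∈ l.flagged then l.charged else insert x l.charged) ∪
        (if e ∈ l.state.tree then {e} else ∅)) p l.refHits).Valid I := by
  have h0 := hl.notMem_accepted he
  have h1 := hl.accepted_subset
  have h2 := hl.ref_subset
  have h3 := hl.flagged_subset_ref
  have h4 := hl.flagged_subset_unseen
  have h5 := hl.notMem_of_charged
  have h6 := hl.cost_le
  have h7 := hl.card_charged_le
  have h8 := hl.hits_le
  have hsA := hs.accepted_subset
  have hxe : x ≠ e := fun h => heB (h ▸ hxB)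
  have hxA : x ∉ l.state.accepted := by grind
  have hxu : x ∈ l.state.unseen := by grind
  have hxZ : x ∉ l.charged := fun h => (h5 x h hxu).2 hxB
  have heF : e ∉ l.flagged := fun h => heB (h3 h)
  have hcard : s.accepted.card = l.state.accepted.card + 1 := by
    rw [hA, Finset.card_insert_of_notMem h0]
  have hsum : ∑ z ∈ (if x ∈ l.flagged then l.charged else insert x l.charged) ∪
      (if e ∈ l.state.tree then {e} else ∅), I.edgeError z = ∑ z ∈ l.charged, I.edgeError z
        + (if x ∈ l.flagged then 0 else I.edgeError x)
        + (if e ∈ l.state.tree then I.edgeError e else 0) := by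
    rw [Finset.sum_union]
    · congr 1
      · split_ifs
        · simp
        · rw [Finset.sum_insert hxZ, add_comm]
      · split_ifs <;> simp
    · split_ifs with ha hb
      all_goals simp only [Finset.disjoint_singleton_right, Finset.disjoint_empty_right]
      · exact fun h => (h5 e h he).1 hb
      · rw [Finset.mem_insert]
        rintro (h | h)
        · exact hxe h.symm
        · exact (h5 e h he).1 (by assumption)
  refine ⟨hs, hx, by grind, by grind, by grind, by grind, ?_, ?_, ?_, by dsimp only; omega⟩
  · dsimp only
    intro z hz hz'
    have hze : z ≠ e := by grind
    by_cases hzx : z = x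
    · subst hzx
      exact ⟨hxT, by simp [hze]⟩
    · have : z ∈ l.charged := by
        rw [Finset.mem_union] at hz
        rcases hz with hz | hz <;> split_ifs at hz <;> simp_all
      grind
  · dsimp only
    rw [hsum]
    have key : I.cost (I.mixedWeight (l.flagged.erase x)) (insert e (l.ref.erase x))
        = I.cost (I.mixedWeight l.flagged) l.ref + I.weight e - I.mixedWeight l.flagged x := by
      rw [PredictedGraph.cost, PredictedGraph.cost, Finset.sum_insert (by simp [heB]),
        ← Finset.add_sum_erase _ _ hxB]
      have : ∑ y ∈ l.ref.erase x, I.mixedWeight (l.flagged.erase x) y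
          = ∑ y ∈ l.ref.erase x, I.mixedWeight l.flagged y :=
        Finset.sum_congr rfl fun y hy => by
          simp [Instance.mixedWeight, Finset.ne_of_mem_erase hy]
      rw [this]
      have : I.mixedWeight (l.flagged.erase x) e = I.weight e := by
        simp [Instance.mixedWeight, heF]
      rw [this]
      ring
    rw [key]
    -- The bound on the weight of e is in terms of the prediction of x. If x is not flagged, it
    -- counted with its true weight, and the difference is charged to x.
    have hd : I.pred x - I.weight x ≤ I.edgeError x := by
      rw [Instance.edgeError, abs_sub_comm]
      exact le_abs_self _
    have hmx : I.mixedWeight l.flagged x = if x ∈ l.flagged then I.pred x else I.weight x := rfl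
    rw [hmx]
    split_ifs at hwe ⊢ <;> linarith
  · dsimp only
    refine (Finset.card_union_le _ _).trans ?_
    have : (if x ∈ l.flagged then l.charged else insert x l.charged).card ≤ l.charged.card + 1 := by
      split_ifs
      · omega
      · exact Finset.card_insert_le _ _
    have : (if e ∈ l.state.tree then {e} else ∅ : Finset I.Edge).card
        ≤ if e ∈ l.state.tree then 1 else 0 := by
      split_ifs <;> simp
    omega

/-- The bookkeeping can be continued with every request. -/
theorem exists_step (hl : l.Valid I) (R : TieBreaking I.toPredictedGraph) {e : I.Edge}
    (he : e ∈ l.state.unseen) :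
    ∃ l' : Ledger I.toPredictedGraph, l'.Valid I ∧ l'.state = R.step l.state (e, I.weight e) ∧
      l'.treeHits = l.treeHits + (if e ∈ l.state.tree \ l.ref then 1 else 0) ∧
      l'.refHits = l.refHits + (if e ∈ l.ref \ l.state.tree then 1 else 0) := by
  have hs := hl.state.step R he (I.weight e)
  obtain ⟨hu, hcases⟩ := R.step_cases l.state e (I.weight e)
  by_cases heB : e ∈ l.ref
  · rcases hcases with ⟨heT, hT, hA⟩ | ⟨heT, g, hg, hcyc, hmax, hle, hT, hA⟩ | ⟨heT, hT, hA, hlt⟩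
    · refine ⟨_, hl.accept_ref he heB hs hu hA (by grind) (q := l.refHits) ?_, rfl, ?_, ?_⟩
      · rw [hT]; omega
      · simp [heB]
      · simp [heT]
    · refine ⟨_, hl.accept_ref he heB hs hu hA (by grind) (q := l.refHits + 1) ?_, rfl, ?_, ?_⟩
      · have : insert e ((l.ref ∩ l.state.tree).erase g) ⊆ l.ref ∩ (R.step l.state (e, I.weight e)).tree := by
          grind
        have := Finset.card_le_card this
        rw [Finset.card_insert_of_notMem (by grind)] at this
        have := Finset.pred_card_le_card_erase (s := l.ref ∩ l.state.tree) (a := g)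
        omega
      · simp [heB]
      · simp [heT, heB]
    · obtain ⟨B, F, h⟩ := hl.reject_ref he heB heT hs hu hA hT hlt
      exact ⟨_, h, rfl, by simp [heT], by simp [heT, heB]⟩
  · rcases hcases with ⟨heT, hT, hA⟩ | ⟨heT, g, hg, hcyc, hmax, hle, hT, hA⟩ | ⟨heT, hT, hA, hlt⟩
    · obtain ⟨x, hxB, hxT, hx1, hx2⟩ := hl.state.tree.exists_exchange hl.ref heT heB
      have hxu : x ∈ l.state.unseen := by
        have h1 := hl.ref_subset
        have h2 := hl.state.accepted_subset
        grind
      have hp := hl.state.pred_le heT he hxT hxu hx2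
      refine ⟨_, hl.accept_of_notMem_ref he heB hs hu hA (by grind) hxB (hT ▸ hxT) hx1 ?_
        (p := l.treeHits + 1) ?_ ?_, rfl, ?_, ?_⟩
      · rw [if_pos heT]
        have : I.weight e - I.pred e ≤ I.edgeError e := le_abs_self _
        linarith
      · simp [heT]
      · have : insert e (l.ref ∩ l.state.tree) ⊆
            insert e (l.ref.erase x) ∩ (R.step l.state (e, I.weight e)).tree := by grind
        have := Finset.card_le_card this
        rw [Finset.card_insert_of_notMem (by grind)] at this
        omega
      · simp [heT, heB]
      · simp [heB]
    · have heT' : e ∈ (R.step l.state (e, I.weight e)).tree := by grind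
      rw [Finset.mem_erase] at hg
      obtain ⟨hgT, -⟩ := (hl.state.tree.onCycle_iff heT hg.1).1 hcyc
      -- The exchange is made against the tree after the swap, so that x lies outside of it and may
      -- be charged. Either x = g, or T - g + x is a spanning tree competing with T; so x is
      -- predicted at least as dear as g, hence at least the true weight of e.
      obtain ⟨x, hxB, hxT, hx1, hx2⟩ := hs.tree.exists_exchange hl.ref heT' heB
      have hxe : x ≠ e := fun h => heB (h ▸ hxB)
      have hxu : x ∈ l.state.unseen := by
        have h1 := hl.ref_subset
        have h2 := hs.accepted_subset
        grind
      have hp : I.pred g ≤ I.pred x := by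
        by_cases hxg : x = g
        · rw [hxg]
        · refine hl.state.pred_le hgT hg.2 (by grind) hxu ?_
          rwa [hT, Finset.erase_insert (by simp [heT])] at hx2
      refine ⟨_, hl.accept_of_notMem_ref he heB hs hu hA (by grind) hxB hxT hx1 ?_
        (p := l.treeHits) ?_ ?_, rfl, ?_, ?_⟩
      · rw [if_neg heT]
        linarith
      · simp [heT]
      · have : insert e ((l.ref ∩ l.state.tree).erase g) ⊆
            insert e (l.ref.erase x) ∩ (R.step l.state (e, I.weight e)).tree := by grind
        have := Finset.card_le_card this
        rw [Finset.card_insert_of_notMem (by grind)] at this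
        have := Finset.pred_card_le_card_erase (s := l.ref ∩ l.state.tree) (a := g)
        omega
      · simp [heT]
      · simp [heB]
    · refine ⟨⟨R.step l.state (e, I.weight e), l.ref, l.flagged, l.charged, l.treeHits, l.refHits⟩,
        ⟨hs, hl.ref, ?_, ?_, hl.flagged_subset_ref, ?_, ?_, hl.cost_le, ?_, ?_⟩, rfl, ?_, ?_⟩
      · exact hA ▸ hl.accepted_subset
      · have := hl.ref_subset
        grind
      · have h1 := hl.flagged_subset_ref
        have h2 := hl.flagged_subset_unseen
        grind
      · have := hl.notMem_of_charged
        grind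
      · exact hA ▸ hl.card_charged_le
      · exact hT ▸ hA ▸ hl.hits_le
      · simp [heT]
      · simp [heB]

end Ledger.Valid

/-! ### Averaging over a uniformly random arrival order. -/

section RandomOrder

variable {α : Type*}

theorem mem_take_ofFn_iff {m t : ℕ} (σ : Fin m → α) {a : α} :
    a ∈ (List.ofFn σ).take t ↔ ∃ s : Fin m, s.val < t ∧ σ s = a := by
  rw [List.mem_take_iff_getElem]
  constructor
  · rintro ⟨i, hi, rfl⟩
    simp only [List.length_ofFn] at hi
    exact ⟨⟨i, by omega⟩, by simp; omega, by simp⟩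
  · rintro ⟨s, hs, rfl⟩
    exact ⟨s, by simp [hs], by simp⟩

theorem take_ofFn_congr {m t : ℕ} {σ τ : Fin m → α} (h : ∀ s : Fin m, s.val < t → σ s = τ s) :
    (List.ofFn σ).take t = (List.ofFn τ).take t := by
  refine List.ext_getElem (by simp) fun i hi hi' => ?_
  simp only [List.length_take, List.length_ofFn] at hi
  simp only [List.getElem_take, List.getElem_ofFn]
  exact h _ (by simp; omega)

/-- A function of the revealed prefix that is preserved on average by every next request is
preserved on average by a uniformly random arrival order. -/
theorem sum_ofFn_eq_of_sum_append_eq [Fintype α] [DecidableEq α] {m : ℕ} (g : List α → ℝ)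
    (hg : ∀ l : List α, l.Nodup → ∑ a with a ∉ l, (g (l ++ [a]) - g l) = 0) :
    ∑ σ : Fin m ≃ α, g (List.ofFn σ) = Fintype.card (Fin m ≃ α) * g [] := by
  have hstep : ∀ t ≤ m, ∑ σ : Fin m ≃ α, g ((List.ofFn σ).take t)
      = Fintype.card (Fin m ≃ α) * g [] := by
    intro t
    induction t with
    | zero => intro _; simp
    | succ t ih =>
      intro ht
      rw [← ih (by omega), ← sub_eq_zero, ← Finset.sum_sub_distrib]
      let k : Fin m := ⟨t, ht⟩
      have htake : ∀ σ : Fin m ≃ α,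
          (List.ofFn σ).take (t + 1) = (List.ofFn σ).take t ++ [σ k] := fun σ => by
        rw [List.take_succ_eq_append_getElem (by simpa using ht)]
        simp [k]
      simp only [htake]
      -- Swapping positions t and s ≥ t keeps the prefix, so any later element is distributed like
      -- the next one.
      have hswap : ∀ s : Fin m, t ≤ s.val →
          ∑ σ : Fin m ≃ α, (g ((List.ofFn σ).take t ++ [σ s]) - g ((List.ofFn σ).take t))
          = ∑ σ : Fin m ≃ α, (g ((List.ofFn σ).take t ++ [σ k]) - g ((List.ofFn σ).take t)) := by
        intro s hs
        rw [← Equiv.sum_comp ((Equiv.swap k s).equivCongr (Equiv.refl α))]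
        refine Finset.sum_congr rfl fun σ _ => ?_
        have : (List.ofFn ((Equiv.swap k s).equivCongr (Equiv.refl α) σ)).take t
            = (List.ofFn σ).take t := by
          refine take_ofFn_congr fun r hr => ?_
          have h1 : r ≠ k := fun h => by simp [h, k] at hr
          have h2 : r ≠ s := fun h => by rw [h] at hr; omega
          simp [Equiv.equivCongr, Equiv.swap_apply_of_ne_of_ne h1 h2]
        rw [this]
        simp [Equiv.equivCongr]
      -- For a fixed order, summing over all later positions is summing over all unrevealed
      -- elements, which gives zero by hypothesis.
      have hzero : ∑ s : Fin m with t ≤ s.val, ∑ σ : Fin m ≃ α,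
          (g ((List.ofFn σ).take t ++ [σ s]) - g ((List.ofFn σ).take t)) = 0 := by
        rw [Finset.sum_comm]
        refine Finset.sum_eq_zero fun σ _ => ?_
        rw [← hg ((List.ofFn σ).take t) ((List.nodup_ofFn.2 σ.injective).sublist
          (List.take_sublist _ _))]
        refine Finset.sum_equiv σ (fun s => ?_) fun s _ => rfl
        simp only [Finset.mem_filter, Finset.mem_univ, true_and, mem_take_ofFn_iff,
          EmbeddingLike.apply_eq_iff_eq, exists_eq_right, not_lt]
      rw [Finset.sum_congr rfl fun s hs => hswap s (Finset.mem_filter.1 hs).2, Finset.sum_const,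
        smul_eq_zero] at hzero
      refine hzero.resolve_left (Finset.card_ne_zero_of_mem (a := k) ?_)
      simp [k]
  have := hstep m le_rfl
  simpa [List.take_of_length_le] using this

end RandomOrder

/-! ### Sums of the largest errors. -/

section Threshold

/-- The sum of the `k` largest entries, bounded below by means of a threshold. -/
theorem exists_threshold_le_sum_take {l : List ℝ} (hl : l.Pairwise (· ≥ ·)) (h0 : ∀ x ∈ l, 0 ≤ x)
    {k : ℕ} (hk : k ≤ l.length) :
    ∃ θ : ℝ, 0 ≤ θ ∧ k * θ + (l.map fun x => max (x - θ) 0).sum ≤ (l.take k).sum := by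
  rw [← List.take_append_drop k l, List.pairwise_append] at hl
  obtain ⟨-, hd, htd⟩ := hl
  -- The threshold is the first entry after the k largest, or 0 if there is none.
  obtain ⟨θ, hθ, h1, h2⟩ : ∃ θ : ℝ, 0 ≤ θ ∧ (∀ x ∈ l.take k, θ ≤ x) ∧ ∀ x ∈ l.drop k, x ≤ θ := by
    cases hdrop : l.drop k with
    | nil => exact ⟨0, le_rfl, fun x hx => h0 x (List.mem_of_mem_take hx), by simp⟩
    | cons a r =>
      rw [hdrop] at hd htd
      refine ⟨a, h0 a (List.mem_of_mem_drop (i := k) (by simp [hdrop])),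
        fun x hx => htd x hx a (by simp), fun x hx => ?_⟩
      rcases List.mem_cons.1 hx with rfl | hx
      · exact le_rfl
      · exact List.rel_of_pairwise_cons hd hx
  refine ⟨θ, hθ, le_of_eq ?_⟩
  have hdrop : ((l.drop k).map fun x => max (x - θ) 0).sum = 0 := by
    refine List.sum_eq_zero fun y hy => ?_
    obtain ⟨x, hx, rfl⟩ := List.mem_map.1 hy
    exact max_eq_right (sub_nonpos.2 (h2 x hx))
  have htake : ∀ r : List ℝ, (∀ x ∈ r, θ ≤ x) →
      r.length * θ + (r.map fun x => max (x - θ) 0).sum = r.sum := by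
    intro r
    induction r with
    | nil => simp
    | cons a r ih =>
      intro h
      rw [List.forall_mem_cons] at h
      simp only [List.length_cons, List.map_cons, List.sum_cons, ← ih h.2,
        max_eq_left (sub_nonneg.2 h.1)]
      push_cast
      ring
  have := htake _ h1
  rw [List.length_take, min_eq_left hk] at this
  rw [← this]
  conv_lhs => rw [← List.take_append_drop k l]
  rw [List.map_append, List.sum_append, hdrop, add_zero]

end Threshold

/-! ### Runs, expected cost and normalized error. -/

namespace Instance

variable (I : Instance.{u})

/-- The sum of the errors of a set of edges, bounded by the total error and a threshold. -/
theorem exists_threshold_error {T : Finset I.Edge} (hT : I.IsSpanningTree T) :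
    ∃ θ : ℝ, 0 ≤ θ ∧ T.card * θ ≤ I.error ∧
      ∀ Z : Finset I.Edge, ∑ z ∈ Z, I.edgeError z ≤ I.error + (Z.card - T.card) * θ := by
  have hsort : (I.sortedErrors : Multiset ℝ) = (Finset.univ : Finset I.Edge).val.map I.edgeError :=
    Multiset.sort_eq _ _
  have hk : Fintype.card I.V - 1 = T.card := by have := hT.card; omega
  have hlen : I.sortedErrors.length = Fintype.card I.Edge := by
    rw [← Multiset.coe_card, hsort]; simp
  obtain ⟨θ, hθ, h⟩ := exists_threshold_le_sum_take (l := I.sortedErrors) (k := T.card)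
    (Multiset.pairwise_sort _ _) (fun x hx => by
      rw [← Multiset.mem_coe, hsort, Multiset.mem_map] at hx
      obtain ⟨e, -, rfl⟩ := hx
      exact abs_nonneg _) (hlen ▸ T.card_le_univ)
  have hsum : (I.sortedErrors.map fun x => max (x - θ) 0).sum
      = ∑ e : I.Edge, max (I.edgeError e - θ) 0 := by
    rw [← Multiset.sum_coe, ← Multiset.map_coe, hsort, Multiset.map_map]
    rfl
  rw [hsum] at h
  have herr : I.error = (I.sortedErrors.take T.card).sum := by rw [error, hk]
  rw [← herr] at h
  refine ⟨θ, hθ, ?_, fun Z => ?_⟩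
  · have : 0 ≤ ∑ e : I.Edge, max (I.edgeError e - θ) 0 :=
      Finset.sum_nonneg fun _ _ => le_max_right _ _
    linarith
  · have h1 : ∑ z ∈ Z, I.edgeError z ≤ ∑ z ∈ Z, (max (I.edgeError z - θ) 0 + θ) :=
      Finset.sum_le_sum fun z _ => by linarith [le_max_left (I.edgeError z - θ) 0]
    have h2 : ∑ z ∈ Z, max (I.edgeError z - θ) 0 ≤ ∑ z : I.Edge, max (I.edgeError z - θ) 0 :=
      Finset.sum_le_sum_of_subset_of_nonneg (Finset.subset_univ _) fun _ _ _ => le_max_right _ _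
    rw [Finset.sum_add_distrib, Finset.sum_const, nsmul_eq_mul] at h1
    linarith

variable {I}

theorem exists_isMST (R : TieBreaking I.toPredictedGraph) :
    ∃ T, I.IsMST I.weight T ∧ I.opt = I.cost I.weight T := by
  classical
  obtain ⟨T, hT, hmin⟩ := (Finset.univ.filter fun T => I.IsSpanningTree T).exists_min_image
    -- The initial tree serves only to show that some spanning tree exists.
    (I.cost I.weight) ⟨R.init, by simpa using R.init_isMST.1⟩
  simp only [Finset.mem_filter, Finset.mem_univ, true_and] at hT hmin
  refine ⟨T, ⟨hT, hmin⟩, IsLeast.csInf_eq ⟨⟨T, hT, rfl⟩, ?_⟩⟩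
  rintro _ ⟨S, hS, rfl⟩
  exact hmin S hS

variable (I) in
/-- The state of the algorithm after the edges in a list have arrived. -/
noncomputable def stateAfter (R : TieBreaking I.toPredictedGraph) (l : List I.Edge) :
    State I.toPredictedGraph :=
  (l.map fun e => (e, I.weight e)).foldl R.step R.initialState

theorem stateAfter_append (R : TieBreaking I.toPredictedGraph) (l : List I.Edge) (e : I.Edge) :
    I.stateAfter R (l ++ [e]) = R.step (I.stateAfter R l) (e, I.weight e) := by
  simp [stateAfter]

theorem mem_unseen_stateAfter (R : TieBreaking I.toPredictedGraph) (l : List I.Edge) {e : I.Edge} :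
    e ∈ (I.stateAfter R l).unseen ↔ e ∉ l := by
  induction l using List.reverseRecOn with
  | nil => simp [stateAfter, TieBreaking.initialState]
  | append_singleton l a ih =>
    rw [stateAfter_append, (R.step_cases _ _ _).1, Finset.mem_erase, ih]
    simp only [List.mem_append, List.mem_singleton]
    tauto

/-- The bookkeeping along all runs of the algorithm. -/
theorem exists_ledger (R : TieBreaking I.toPredictedGraph) :
    ∃ L : List I.Edge → Ledger I.toPredictedGraph,
      (L []).treeHits = 0 ∧ (L []).refHits = 0 ∧
      (∀ l, l.Nodup → (L l).Valid I ∧ (L l).state = I.stateAfter R l) ∧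
      ∀ l, l.Nodup → ∀ e ∉ l,
        (L (l ++ [e])).treeHits
          = (L l).treeHits + (if e ∈ (L l).state.tree \ (L l).ref then 1 else 0) ∧
        (L (l ++ [e])).refHits
          = (L l).refHits + (if e ∈ (L l).ref \ (L l).state.tree then 1 else 0) := by
  classical
  obtain ⟨T, hT, hopt⟩ := I.exists_isMST R
  have hnext : ∀ (l : Ledger I.toPredictedGraph) (e : I.Edge), ∃ l' : Ledger I.toPredictedGraph,
      l.Valid I → e ∈ l.state.unseen →
      l'.Valid I ∧ l'.state = R.step l.state (e, I.weight e) ∧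
      l'.treeHits = l.treeHits + (if e ∈ l.state.tree \ l.ref then 1 else 0) ∧
      l'.refHits = l.refHits + (if e ∈ l.ref \ l.state.tree then 1 else 0) := by
    intro l e
    by_cases h : l.Valid I ∧ e ∈ l.state.unseen
    · obtain ⟨l', hl'⟩ := h.1.exists_step R h.2
      exact ⟨l', fun _ _ => hl'⟩
    -- A junk value, which makes the successor ledger a total function and the ledger a function of
    -- the revealed prefix.
    · exact ⟨l, fun h1 h2 => (h ⟨h1, h2⟩).elim⟩
  choose next hnext using hnext
  let L : List I.Edge → Ledger I.toPredictedGraph :=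
    fun l => l.foldl next ⟨R.initialState, T, ∅, ∅, 0, 0⟩
  have happ : ∀ l e, L (l ++ [e]) = next (L l) e := fun l e => by simp [L]
  have hvalid : ∀ l : List I.Edge, l.Nodup → (L l).Valid I ∧ (L l).state = I.stateAfter R l := by
    intro l
    induction l using List.reverseRecOn with
    | nil =>
      refine fun _ => ⟨⟨State.Valid.initial R, hT.1, by simp [L, TieBreaking.initialState],
        by simp [L, TieBreaking.initialState], by simp [L], by simp [L], by simp [L], ?_,
        by simp [L], by simp [L]⟩, rfl⟩
      simp [L, hopt, PredictedGraph.cost, mixedWeight]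
    | append_singleton l a ih =>
      intro hla
      obtain ⟨hl, ha⟩ : l.Nodup ∧ a ∉ l := by
        have := List.nodup_append.1 hla
        exact ⟨this.1, fun h => this.2.2 a h a (by simp) rfl⟩
      obtain ⟨hv, hst⟩ := ih hl
      have := hnext (L l) a hv (by rw [hst, mem_unseen_stateAfter]; exact ha)
      rw [happ, stateAfter_append, ← hst]
      exact ⟨this.1, this.2.1⟩
  refine ⟨L, rfl, rfl, hvalid, fun l hl e he => ?_⟩
  obtain ⟨hv, hst⟩ := hvalid l hl
  rw [happ]
  exact (hnext (L l) e hv (by rw [hst, mem_unseen_stateAfter]; exact he)).2.2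

/-- The constant is 1 + 2/3: one η for the k largest errors, and 2/3 for the expected surplus of
charges, which is at most 2k/3, each weighing θ. -/
theorem expectedCost_le (A : GFtP.{u}) (I : Instance.{u}) :
    A.expectedCost I ≤ I.opt + 5 / 3 * I.error := by
  set R := A I.toPredictedGraph
  obtain ⟨L, h1, h2, hvalid, hhits⟩ := I.exists_ledger R
  have hR := R.init_isMST.1
  set k := R.init.card
  obtain ⟨θ, hθ, hkθ, hZ⟩ := I.exists_threshold_error hR
  have hmart : ∑ σ : I.Order, (((L (List.ofFn σ)).treeHits : ℝ) - (L (List.ofFn σ)).refHits) = 0 := by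
    rw [sum_ofFn_eq_of_sum_append_eq (fun l => ((L l).treeHits : ℝ) - (L l).refHits)]
    · simp [h1, h2]
    intro l hl
    obtain ⟨hv, hst⟩ := hvalid l hl
    have hunseen : ∀ e, e ∈ (L l).state.unseen ↔ e ∉ l := fun e => by
      rw [hst, mem_unseen_stateAfter]
    have ha1 := hv.state.accepted_subset
    have ha2 := hv.state.tree_subset
    have ha3 := hv.accepted_subset
    have ha4 := hv.ref_subset
    have hterm : ∀ e ∈ Finset.univ.filter (· ∉ l),
        (((L (l ++ [e])).treeHits : ℝ) - (L (l ++ [e])).refHits)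
          - (((L l).treeHits : ℝ) - (L l).refHits)
        = (if e ∈ (L l).state.tree \ (L l).ref then 1 else 0)
          - (if e ∈ (L l).ref \ (L l).state.tree then 1 else 0) := by
      intro e he
      obtain ⟨e1, e2⟩ := hhits l hl e (Finset.mem_filter.1 he).2
      rw [e1, e2]
      push_cast
      ring
    rw [Finset.sum_congr rfl hterm, Finset.sum_sub_distrib, Finset.sum_boole, Finset.sum_boole,
      Finset.filter_filter, Finset.filter_filter, sub_eq_zero, Nat.cast_inj]
    have e1 : (Finset.univ.filter fun e => e ∉ l ∧ e ∈ (L l).state.tree \ (L l).ref)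
        = (L l).state.tree \ (L l).ref := by
      ext e
      have := hunseen e
      simp only [Finset.mem_filter, Finset.mem_univ, true_and, and_iff_right_iff_imp]
      grind
    have e2 : (Finset.univ.filter fun e => e ∉ l ∧ e ∈ (L l).ref \ (L l).state.tree)
        = (L l).ref \ (L l).state.tree := by
      ext e
      have := hunseen e
      simp only [Finset.mem_filter, Finset.mem_univ, true_and, and_iff_right_iff_imp]
      grind
    rw [e1, e2]
    -- Two spanning trees have equally many edges, hence equally large differences.
    refine Finset.card_sdiff_comm ?_
    have := hv.ref.card
    have := hv.state.tree.card
    omega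
  have hfinal : ∀ σ : I.Order,
      A.algCost I σ ≤ I.opt + I.error + (L (List.ofFn σ)).treeHits * θ ∧
      2 * (L (List.ofFn σ)).treeHits + (L (List.ofFn σ)).refHits ≤ 2 * k := by
    intro σ
    obtain ⟨hv, hst⟩ := hvalid (List.ofFn σ) (List.nodup_ofFn.2 σ.injective)
    generalize L (List.ofFn σ) = l at hv hst
    have hunseen : l.state.unseen = ∅ := by
      ext e
      rw [hst, mem_unseen_stateAfter, List.mem_ofFn]
      simp only [Finset.notMem_empty, iff_false, not_not]
      exact σ.surjective e
    have hAB : l.state.accepted = l.ref :=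
      hv.accepted_subset.antisymm (by simpa [hunseen] using hv.ref_subset)
    have hAT : l.state.accepted = l.state.tree :=
      hv.state.accepted_subset.antisymm (by simpa [hunseen] using hv.state.tree_subset)
    have hF : l.flagged = ∅ := Finset.subset_empty.1 (hunseen ▸ hv.flagged_subset_unseen)
    have hAk : l.state.accepted.card = k := by
      have := hv.ref.card
      have := hR.card
      rw [hAB]
      omega
    have hcost : A.algCost I σ = I.cost I.weight l.state.accepted := by
      rw [GFtP.algCost, TieBreaking.output, hst, stateAfter, requests, List.map_ofFn]
      rfl
    constructor
    · have hc := hv.cost_le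
      rw [hF, ← hAB] at hc
      have hmix : I.mixedWeight ∅ = I.weight := by
        funext e
        simp [mixedWeight]
      rw [hmix, ← hcost] at hc
      have hcard : (l.charged.card : ℝ) - k ≤ l.treeHits := by
        have := hv.card_charged_le
        rw [hAk] at this
        have : (l.charged.card : ℝ) ≤ l.treeHits + k := by exact_mod_cast this
        linarith
      have := mul_le_mul_of_nonneg_right hcard hθ
      linarith [hZ l.charged]
    · have := hv.hits_le
      rw [← hAB, ← hAT, Finset.inter_self, hAk] at this
      omega
  have hpos : (0 : ℝ) < Fintype.card I.Order :=
    Nat.cast_pos.2 (Fintype.card_pos_iff.2 ⟨(Fintype.equivFin I.Edge).symm⟩)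
  -- On average the two hit counts agree, so 2p + q ≤ 2k becomes 3p ≤ 2k.
  have hhit : ∑ σ : I.Order, ((L (List.ofFn σ)).treeHits : ℝ)
      ≤ Fintype.card I.Order * (2 / 3 * k) := by
    have h3 : ∑ σ : I.Order, (2 * ((L (List.ofFn σ)).treeHits : ℝ) + (L (List.ofFn σ)).refHits)
        ≤ ∑ σ : I.Order, (2 * k : ℝ) :=
      Finset.sum_le_sum fun σ _ => by exact_mod_cast (hfinal σ).2
    rw [Finset.sum_add_distrib, ← Finset.mul_sum, Finset.sum_const, nsmul_eq_mul,
      Finset.card_univ] at h3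
    rw [Finset.sum_sub_distrib] at hmart
    linarith
  have hsum : ∑ σ : I.Order, A.algCost I σ
      ≤ ∑ σ : I.Order, (I.opt + I.error + (L (List.ofFn σ)).treeHits * θ) :=
    Finset.sum_le_sum fun σ _ => (hfinal σ).1
  rw [Finset.sum_add_distrib, ← Finset.sum_mul, Finset.sum_const, nsmul_eq_mul,
    Finset.card_univ] at hsum
  rw [GFtP.expectedCost, div_le_iff₀ hpos]
  have h4 := mul_le_mul_of_nonneg_right hhit hθ
  have h5 := mul_le_mul_of_nonneg_left hkθ hpos.le
  linarith

theorem error_nonneg (I : Instance.{u}) (R : TieBreaking I.toPredictedGraph) : 0 ≤ I.error := by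
  obtain ⟨θ, hθ, h, -⟩ := I.exists_threshold_error R.init_isMST.1
  exact (by positivity : (0 : ℝ) ≤ R.init.card * θ).trans h

/-- Also in the degenerate case `opt = 0` of the graph with one vertex, where there is no error. -/
theorem normalizedError_mul_opt (I : Instance.{u}) (R : TieBreaking I.toPredictedGraph) :
    I.normalizedError * I.opt = I.error := by
  obtain ⟨T, hT, hopt⟩ := I.exists_isMST R
  rcases T.eq_empty_or_nonempty with rfl | hne
  · have hcard := hT.1.card
    rw [Finset.card_empty, zero_add] at hcard
    simp [normalizedError, error, ← hcard]
  · have : 0 < I.opt := hopt ▸ Finset.sum_pos (fun e _ => I.weight_pos e) hne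
    exact div_mul_cancel₀ _ this.ne'

end Instance

end WMST

theorem mainTheorem1 (A : WMST.GFtP.{u}) :
    (∀ I : WMST.Instance.{u},
      A.expectedCost I ≤ (1 + (1 + Real.log 2) * I.normalizedError) * I.opt) ∧
    ∀ ε : ℝ, 0 ≤ ε →
      A.randomOrderRatio ε ≤ ((1 + (1 + Real.log 2) * ε : ℝ) : EReal) := by
  have hmain : ∀ I : WMST.Instance.{u},
      A.expectedCost I ≤ (1 + (1 + Real.log 2) * I.normalizedError) * I.opt := by
    intro I
    have h := WMST.Instance.expectedCost_le A I
    -- Only ln 2 ≥ 2/3 is needed.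
    have hlog := Real.log_two_gt_d9
    have herr := I.error_nonneg (A I.toPredictedGraph)
    rw [add_mul, one_mul, mul_assoc, I.normalizedError_mul_opt (A I.toPredictedGraph)]
    have : 5 / 3 * I.error ≤ (1 + Real.log 2) * I.error :=
      mul_le_mul_of_nonneg_right (by linarith) herr
    linarith
  refine ⟨hmain, fun ε _ => sInf_le ⟨_, rfl, 0, fun I hI => ?_⟩⟩
  rw [sub_zero, ← hI]
  exact hmain I
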